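/- \textbf{Setting.} Formulas are built from propositional variables $p_0,p_1,\dots$ and $\bot$ by $\to$, $\Box$ and $\Box^+$. A sequent is an expression $\Sigma;\Gamma\Rightarrow\Delta$, where $\Sigma$ is an arbitrary (possibly infinite) set of formulas and $\Gamma,\Delta$ are finite multisets of formulas. For a multiset $\Gamma=A_1,\dots,A_n$ let $\Box\Gamma=\Box A_1,\dots,\Box A_n$ and $\Box^+\Gamma=\Box^+A_1,\dots,\Box^+A_n$. The calculus $\mathsf S$ has the initial sequents $\Sigma;\Gamma,p\Rightarrow p,\Delta$ ($p$ a propositional variable) and $\Sigma;\Gamma,\bot\Rightarrow\Delta$, and the rules $$\frac{\Sigma;\Gamma,B\Rightarrow\Delta\qquad \Sigma;\Gamma\Rightarrow A,\Delta}{\Sigma;\Gamma,A\to B\Rightarrow\Delta}\,(\to_L)\qquad \frac{\Sigma;\Gamma,A\Rightarrow B,\Delta}{\Sigma;\Gamma\Rightarrow A\to B,\Delta}\,(\to_R)$$ $$\frac{\Sigma;\Sigma_0,\Lambda,\Pi,\Box^+\Pi\Rightarrow A}{\Sigma;\Phi,\Box\Lambda,\Box^+\Pi\Rightarrow\Box A,\Psi}\,(\Box)\qquad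 \frac{\Sigma;\Sigma_0,\Lambda,\Pi,\Box^+\Pi\Rightarrow A\qquad \Sigma;\Sigma_0,\Lambda,\Pi,\Box^+\Pi\Rightarrow\Box^+A}{\Sigma;\Phi,\Box\Lambda,\Box^+\Pi\Rightarrow\Box^+A,\Psi}\,(\Box^+)$$ where $\Sigma_0$ is a finite subset of $\Sigma$. The last two rules are the modal rules, with principal formulas $\Box A$ and $\Box^+A$ respectively; an application of a modal rule is slim if neither $\Lambda$ nor $\Pi$ contains repetitions. The calculus $\mathsf S+\mathsf{cut}$ adds the rule $$\frac{\Sigma;\Gamma\Rightarrow A,\Delta\qquad \Sigma;\Gamma,A\Rightarrow\Delta}{\Sigma;\Gamma\Rightarrow\Delta}\,(\mathsf{cut}).$$ An $\infty$-proof is a possibly infinite tree of sequents constructed according to the rules of $\mathsf S+\mathsf{cut}$, in which every leaf is marked by an initial sequent and every infinite branch has a tail such that: (a) all applications of $(\Box^+)$ in the tail have the same principal formula; (b) the tail passes through the right premise of $(\Box^+)$ infinitely many times; (c) the tail does not pass through the left premise of $(\Box^+)$; (d) there are no applications of $(\Box)$ in the tail. An $\infty$-proof is cut-free if it contains no application of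 $(\mathsf{cut})$, and slim if every application of a modal rule in it is slim. A sequent is provable in $\mathsf S+\mathsf{cut}$ if it marks the root of some $\infty$-proof. \textbf{Theorem (cut elimination).} If a sequent $\Sigma;\Gamma\Rightarrow\Delta$ is provable in $\mathsf S+\mathsf{cut}$, then there is an $\infty$-proof of $\Sigma;\Gamma\Rightarrow\Delta$ that is both slim and cut-free. -/

import Mathlib

namespace KPlus

/-- Formulas of the modal logic of transitive closure. -/
inductive Fm : Type
  | var (n : ℕ) : Fm
  | bot : Fm
  | imp (A B : Fm) : Fm
  | box (A : Fm) : Fm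
  | boxPlus (A : Fm) : Fm

/-- Sequents `Sig; ant ⇒ suc`: an arbitrary set of formulas and two finite multisets. -/
@[ext] structure Sequent where
  Sig : Set Fm
  ant : Multiset Fm
  suc : Multiset Fm

/-- Instances of the initial sequents and of the inference rules of the calculus with cut. -/
inductive Inference : Type
  /-- `Sig; Γ, p ⇒ p, Δ` with `p` a propositional variable -/
  | ax (Sig : Set Fm) (Γ Δ : Multiset Fm) (p : ℕ)
  /-- `Sig; Γ, ⊥ ⇒ Δ` -/
  | botL (Sig : Set Fm) (Γ Δ : Multiset Fm)
  /-- from `Sig; Γ, B ⇒ Δ` and `Sig; Γ ⇒ A, Δ` infer `Sig; Γ, A → B ⇒ Δ` -/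
  | impL (Sig : Set Fm) (Γ Δ : Multiset Fm) (A B : Fm)
  /-- from `Sig; Γ, A ⇒ B, Δ` infer `Sig; Γ ⇒ A → B, Δ` -/
  | impR (Sig : Set Fm) (Γ Δ : Multiset Fm) (A B : Fm)
  /-- from `Sig; Sig₀, Λ, P, □⁺P ⇒ A` infer `Sig; Φ, □Λ, □⁺P ⇒ □A, Ψ` -/
  | box (Sig : Set Fm) (Sig₀ : Finset Fm) (hSig : (Sig₀ : Set Fm) ⊆ Sig)
      (Λ P Φ Ψ : Multiset Fm) (A : Fm)
  /-- from `Sig; Sig₀, Λ, P, □⁺P ⇒ A` and `Sig; Sig₀, Λ, P, □⁺P ⇒ □⁺A`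
  infer `Sig; Φ, □Λ, □⁺P ⇒ □⁺A, Ψ` -/
  | boxPlus (Sig : Set Fm) (Sig₀ : Finset Fm) (hSig : (Sig₀ : Set Fm) ⊆ Sig)
      (Λ P Φ Ψ : Multiset Fm) (A : Fm)
  /-- from `Sig; Γ ⇒ A, Δ` and `Sig; Γ, A ⇒ Δ` infer `Sig; Γ ⇒ Δ` -/
  | cut (Sig : Set Fm) (Γ Δ : Multiset Fm) (A : Fm)

namespace Inference

/-- The conclusion of an inference (the sequent itself for an initial sequent). -/
def concl : Inference → Sequent
  | ax Sig Γ Δ p => ⟨Sig, Fm.var p ::ₘ Γ, Fm.var p ::ₘ Δ⟩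
  | botL Sig Γ Δ => ⟨Sig, Fm.bot ::ₘ Γ, Δ⟩
  | impL Sig Γ Δ A B => ⟨Sig, Fm.imp A B ::ₘ Γ, Δ⟩
  | impR Sig Γ Δ A B => ⟨Sig, Γ, Fm.imp A B ::ₘ Δ⟩
  | box Sig _ _ Λ P Φ Ψ A => ⟨Sig, Φ + Λ.map Fm.box + P.map Fm.boxPlus, Fm.box A ::ₘ Ψ⟩
  | boxPlus Sig _ _ Λ P Φ Ψ A =>
      ⟨Sig, Φ + Λ.map Fm.box + P.map Fm.boxPlus, Fm.boxPlus A ::ₘ Ψ⟩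
  | cut Sig Γ Δ _ => ⟨Sig, Γ, Δ⟩

/-- The premises of an inference, from left to right (none for an initial sequent). -/
def premises : Inference → List Sequent
  | ax _ _ _ _ => []
  | botL _ _ _ => []
  | impL Sig Γ Δ A B => [⟨Sig, B ::ₘ Γ, Δ⟩, ⟨Sig, Γ, A ::ₘ Δ⟩]
  | impR Sig Γ Δ A B => [⟨Sig, A ::ₘ Γ, B ::ₘ Δ⟩]
  | box Sig Sig₀ _ Λ P _ _ A => [⟨Sig, Sig₀.val + Λ + P + P.map Fm.boxPlus, {A}⟩]
  | boxPlus Sig Sig₀ _ Λ P _ _ A =>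
      [⟨Sig, Sig₀.val + Λ + P + P.map Fm.boxPlus, {A}⟩,
       ⟨Sig, Sig₀.val + Λ + P + P.map Fm.boxPlus, {Fm.boxPlus A}⟩]
  | cut Sig Γ Δ A => [⟨Sig, Γ, A ::ₘ Δ⟩, ⟨Sig, A ::ₘ Γ, Δ⟩]

/-- The inference is an application of the rule `(□)`. -/
def IsBox : Inference → Prop
  | box _ _ _ _ _ _ _ _ => True
  | _ => False

/-- The inference is an application of the rule `(□⁺)` with principal formula `C`. -/
def IsBoxPlus (C : Fm) : Inference → Prop
  | boxPlus _ _ _ _ _ _ _ A => C = Fm.boxPlus A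
  | _ => False

/-- The inference is an application of the rule `(cut)`. -/
def IsCut : Inference → Prop
  | cut _ _ _ _ => True
  | _ => False

/-- If the inference is an application of a modal rule, then it is slim: the multisets
`Λ` and `P` of its side formulas (with `□`, `□⁺` removed) have no repetitions. -/
def IsSlim : Inference → Prop
  | box _ _ _ Λ P _ _ _ => Λ.Nodup ∧ P.Nodup
  | boxPlus _ _ _ Λ P _ _ _ => Λ.Nodup ∧ P.Nodup
  | _ => True

end Inference

/-- The node at depth `n` on the branch that takes its `k`-th step to premise number `f k`. -/
def branchNode (f : ℕ → ℕ) : ℕ → List ℕ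
  | 0 => []
  | n + 1 => branchNode f n ++ [f n]

/-- Non-well-founded proofs. Nodes are addressed by lists of natural numbers read from the root
`[]`, the `i`-th child of `a` being `a ++ [i]`; `label a = none` means that there is no node
at `a`. Every node carries the inference of which it is the conclusion. -/
structure InfProof where
  label : List ℕ → Option Inference
  root_isSome : (label []).isSome
  /-- The children of a node are marked exactly by the premises of its inference (so leaves are
  marked by initial sequents), and addresses that are not nodes have no children. -/
  step : ∀ (a : List ℕ) (i : ℕ),
    (label (a ++ [i])).map Inference.concl = (label a).bind fun r => r.premises[i]?
  /-- Every infinite branch has a tail (its nodes of depth at least `N`) such that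
  (a) all applications of `(□⁺)` in the tail have the same principal formula `C`;
  (b) the tail passes through the right premise of `(□⁺)` infinitely often;
  (c) the tail does not pass through the left premise of `(□⁺)`;
  (d) there are no applications of `(□)` in the tail. -/
  progress : ∀ f : ℕ → ℕ, (∀ n, (label (branchNode f n)).isSome) →
    ∃ (N : ℕ) (C : Fm),
      (∀ n ≥ N, ∀ r ∈ label (branchNode f n), ∀ D, r.IsBoxPlus D → D = C) ∧
      (∀ m ≥ N, ∃ n ≥ m, ∃ r ∈ label (branchNode f n), (∃ D, r.IsBoxPlus D) ∧ f n = 1) ∧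
      (∀ n ≥ N, ∀ r ∈ label (branchNode f n), (∃ D, r.IsBoxPlus D) → f n ≠ 0) ∧
      (∀ n ≥ N, ∀ r ∈ label (branchNode f n), ¬ r.IsBox)

namespace InfProof

/-- The sequent that marks the root. -/
def root (π : InfProof) : Sequent := ((π.label []).get π.root_isSome).concl

/-- There are no applications of `(cut)`. -/
def CutFree (π : InfProof) : Prop := ∀ a, ∀ r ∈ π.label a, ¬ r.IsCut

/-- All applications of modal rules are slim. -/
def Slim (π : InfProof) : Prop := ∀ a, ∀ r ∈ π.label a, r.IsSlim

end InfProof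

/-- Provability in the calculus with cut. -/
def ProvableWithCut (S : Sequent) : Prop := ∃ π : InfProof, π.root = S

end KPlus

/-!
The slim cut-free underivable sequents `Σ; Γ ⇒ Δ` with fixed `Σ` are the points of a canonical
model, in which `□⁺A` denotes the greatest fixed point of `Y ↦ □(A ∩ Y)`. Since the premises of a
modal rule contain only finitely many formulas of `Σ`, the box is interpreted by filters of
neighbourhoods rather than by an accessibility relation. Every underivable sequent has a
counterexample in this model. The critical case is a point with `□⁺A` on the right that lies in
`□⁺X`, where no point of `X` refutes `A`: membership in the greatest fixed point can be unfolded
forever, which yields an infinite slim cut-free proof of the sequent, a contradiction.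

A sequent provable with cut has no counterexample in any model that validates the boxed formulas of
`Σ`. If `□⁺A` is false at a world, some ordinal stage of the approximation of the greatest fixed
point detects this. Counterexamples can be followed upwards through all rules, including cut, and
in the tail of the resulting branch the ordinal for the common principal formula never increases
and drops at every right premise of `(□⁺)`.
-/

namespace KPlus

open Filter OrderHom OrdinalApprox

/-! ### Branches of proofs -/

namespace Inference

/-- The inference is an application of `(□)` or `(□⁺)`. -/
def IsModal (r : Inference) : Prop := r.IsBox ∨ ∃ C, r.IsBoxPlus C

/-- The inference may occur in a slim cut-free proof. -/
def IsSlimCutFree (r : Inference) : Prop := r.IsSlim ∧ ¬ r.IsCut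

/-- Conditions (a), (c) and (d) on the tail of a branch, at a single step: the branch passes from
the conclusion of `r` to its premise number `i`, and `C` is the principal formula in (a). -/
def IsTailStep (C : Fm) (r : Inference) (i : ℕ) : Prop :=
  (∀ D, r.IsBoxPlus D → D = C ∧ i ≠ 0) ∧ ¬ r.IsBox

variable {r : Inference} {C D : Fm}

theorem IsBoxPlus.unique (hC : r.IsBoxPlus C) (hD : r.IsBoxPlus D) : D = C := by
  cases r <;> simp_all [IsBoxPlus]

theorem IsBoxPlus.not_isBox (hC : r.IsBoxPlus C) : ¬ r.IsBox := by
  cases r <;> simp_all [IsBoxPlus, IsBox]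

theorem IsBoxPlus.isTailStep_one (hC : r.IsBoxPlus C) : r.IsTailStep C 1 :=
  ⟨fun _ hD => ⟨hC.unique hD, one_ne_zero⟩, hC.not_isBox⟩

theorem isTailStep_of_not_isModal (hr : ¬ r.IsModal) (C : Fm) (i : ℕ) : r.IsTailStep C i :=
  ⟨fun D hD => (hr (.inr ⟨D, hD⟩)).elim, fun h => hr (.inl h)⟩

theorem Sig_of_mem_premises {S : Sequent} (hS : S ∈ r.premises) : S.Sig = r.concl.Sig := by
  cases r <;> simp only [premises, List.mem_cons, List.not_mem_nil, or_false] at hS <;>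
    first | contradiction | (rcases hS with rfl | rfl <;> rfl)

end Inference

/-- The branch with inferences `r` that takes its steps according to `f` satisfies the tail
condition in the definition of `InfProof`. -/
def Progresses (r : ℕ → Inference) (f : ℕ → ℕ) : Prop :=
  ∃ C, (∀ᶠ n in atTop, (r n).IsTailStep C (f n)) ∧
    ∃ᶠ n in atTop, (r n).IsBoxPlus C ∧ f n = 1

theorem progresses_iff {L : ℕ → Option Inference} {r : ℕ → Inference} {f : ℕ → ℕ}
    (hL : ∀ n, L n = some (r n)) :
    Progresses r f ↔ ∃ (N : ℕ) (C : Fm),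
      (∀ n ≥ N, ∀ r ∈ L n, ∀ D, r.IsBoxPlus D → D = C) ∧
      (∀ m ≥ N, ∃ n ≥ m, ∃ r ∈ L n, (∃ D, r.IsBoxPlus D) ∧ f n = 1) ∧
      (∀ n ≥ N, ∀ r ∈ L n, (∃ D, r.IsBoxPlus D) → f n ≠ 0) ∧
      (∀ n ≥ N, ∀ r ∈ L n, ¬ r.IsBox) := by
  simp only [hL, Option.mem_some_iff, forall_eq', exists_eq_left']
  constructor
  · rintro ⟨C, htail, hright⟩
    obtain ⟨N, hN⟩ := eventually_atTop.mp htail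
    refine ⟨N, C, fun n hn D hD => ((hN n hn).1 D hD).1, fun m _ => ?_,
      fun n hn ⟨D, hD⟩ => ((hN n hn).1 D hD).2, fun n hn => (hN n hn).2⟩
    obtain ⟨n, hn, hC, hf⟩ := frequently_atTop.mp hright m
    exact ⟨n, hn, ⟨C, hC⟩, hf⟩
  · rintro ⟨N, C, hprincipal, hright, hleft, hbox⟩
    refine ⟨C, eventually_atTop.mpr ⟨N, fun n hn =>
      ⟨fun D hD => ⟨hprincipal n hn D hD, hleft n hn ⟨D, hD⟩⟩, hbox n hn⟩⟩,
      frequently_atTop.mpr fun m => ?_⟩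
    obtain ⟨n, hn, ⟨D, hD⟩, hf⟩ := hright (max m N) (le_max_right m N)
    obtain rfl := hprincipal n (le_of_max_le_right hn) D hD
    exact ⟨n, le_of_max_le_left hn, hD, hf⟩

theorem Progresses.of_add {r : ℕ → Inference} {f : ℕ → ℕ} (k : ℕ)
    (h : Progresses (fun n => r (n + k)) fun n => f (n + k)) : Progresses r f := by
  obtain ⟨C, htail, hright⟩ := h
  refine ⟨C, ?_, ?_⟩ <;> rw [← map_add_atTop_eq_nat k]
  · exact htail
  · exact hright

theorem progresses_of_rank {α : Type*} [LT α] [WellFoundedLT α] {C : Fm} {r : ℕ → Inference}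
    {f : ℕ → ℕ} (rank : ℕ → α)
    (h : ∀ n, ¬ (r n).IsModal ∧ rank (n + 1) < rank n ∨ (r n).IsBoxPlus C ∧ f n = 1) :
    Progresses r f := by
  refine ⟨C, .of_forall fun n => ?_, frequently_atTop.mpr fun m => ?_⟩
  · rcases h n with ⟨hr, -⟩ | ⟨hC, hf⟩
    · exact Inference.isTailStep_of_not_isModal hr C (f n)
    · exact hf ▸ hC.isTailStep_one
  · obtain ⟨k, hk⟩ :=
      WellFounded.not_rel_apply_succ (r := (· < ·)) fun k => rank (m + k)
    exact ⟨m + k, Nat.le_add_right m k, (h (m + k)).resolve_left fun h => hk h.2⟩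

namespace InfProof

theorem map_concl_label_nil (π : InfProof) :
    (π.label []).map Inference.concl = some π.root := by
  obtain ⟨r, hr⟩ := Option.isSome_iff_exists.mp π.root_isSome
  simp [root, hr]

theorem progresses (π : InfProof) {r : ℕ → Inference} {f : ℕ → ℕ}
    (h : ∀ n, π.label (branchNode f n) = some (r n)) : Progresses r f :=
  (progresses_iff h).mpr (π.progress f fun n => by simp [h n])

theorem exists_branch {W : Type*} (π : InfProof) {P : W → Sequent → Prop}
    {Q : Inference → ℕ → W → W → Prop}
    (hstep : ∀ w r, P w r.concl → ∃ i v S, r.premises[i]? = some S ∧ P v S ∧ Q r i w v)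
    {w : W} (hw : P w π.root) :
    ∃ (f : ℕ → ℕ) (r : ℕ → Inference) (s : ℕ → W),
      (∀ n, π.label (branchNode f n) = some (r n)) ∧ ∀ n, Q (r n) (f n) (s n) (s (n + 1)) := by
  let State := {x : List ℕ × Inference × W // π.label x.1 = some x.2.1 ∧ P x.2.2 x.2.1.concl}
  have hnext (x : State) : ∃ (i : ℕ) (y : State), y.1.1 = x.1.1 ++ [i] ∧
      Q x.1.2.1 i x.1.2.2 y.1.2.2 := by
    obtain ⟨⟨a, r, w⟩, hr, hw⟩ := x
    obtain ⟨i, v, S, hS, hv, hQ⟩ := hstep w r hw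
    have hchild := π.step a i
    rw [hr, Option.bind_some, hS] at hchild
    obtain ⟨r', hr', rfl⟩ := Option.map_eq_some_iff.mp hchild
    exact ⟨i, ⟨⟨a ++ [i], r', v⟩, hr', hv⟩, rfl, hQ⟩
  choose dir next haddress hQ using hnext
  obtain ⟨r₀, hr₀, hroot⟩ := Option.map_eq_some_iff.mp π.map_concl_label_nil
  let x (n : ℕ) : State := next^[n] ⟨⟨[], r₀, w⟩, hr₀, hroot ▸ hw⟩
  have hx (n : ℕ) : x (n + 1) = next (x n) := Function.iterate_succ_apply' ..
  have hbranch (n : ℕ) : branchNode (fun n => dir (x n)) n = (x n).1.1 := by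
    induction n with
    | zero => rfl
    | succ n ih => rw [hx, haddress, branchNode, ih]
  refine ⟨fun n => dir (x n), fun n => (x n).1.2.1, fun n => (x n).1.2.2, fun n => ?_,
    fun n => ?_⟩
  · rw [hbranch]
    exact (x n).2.1
  · simpa only [hx] using hQ (x n)

end InfProof

/-! ### Proof graphs -/

/-- A slim cut-free proof folded into a graph: a state carries an inference, and `next s i` is the
state at premise number `i` of that inference, if there is such a premise. Every state unfolds into
a proof of the conclusion of its inference, see `ProofGraph.exists_unfolding`. -/
structure ProofGraph (σ : Type*) where
  rule : σ → Inference
  next : σ → ℕ → Option σ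
  map_concl_next : ∀ s i, (next s i).map (fun t => (rule t).concl) = (rule s).premises[i]?
  isSlimCutFree : ∀ s, (rule s).IsSlimCutFree
  progresses : ∀ (s : ℕ → σ) (f : ℕ → ℕ), (∀ n, next (s n) (f n) = some (s (n + 1))) →
    Progresses (fun n => rule (s n)) f

namespace ProofGraph

/-- The state reached from `s` by following the address of a node. -/
def walk {σ : Type*} (G : ProofGraph σ) (s : σ) (a : List ℕ) : Option σ := a.foldlM G.next s

theorem walk_append_singleton {σ : Type*} (G : ProofGraph σ) (s : σ) (a : List ℕ) (i : ℕ) :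
    G.walk s (a ++ [i]) = (G.walk s a).bind fun t => G.next t i := by
  simp [walk]

theorem exists_unfolding {σ : Type*} (G : ProofGraph σ) (s : σ) :
    ∃ π : InfProof, π.root = (G.rule s).concl ∧ π.Slim ∧ π.CutFree := by
  have hslim (a : List ℕ) : ∀ r ∈ (G.walk s a).map G.rule, r.IsSlimCutFree := by
    intro r hr
    obtain ⟨t, -, rfl⟩ := Option.map_eq_some_iff.mp hr
    exact G.isSlimCutFree t
  refine ⟨⟨fun a => (G.walk s a).map G.rule, rfl, fun a i => ?_, fun f hf => ?_⟩, rfl,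
    fun a r hr => (hslim a r hr).1, fun a r hr => (hslim a r hr).2⟩
  · rw [walk_append_singleton]
    cases G.walk s a with
    | none => rfl
    | some t => simpa [Function.comp_def] using G.map_concl_next t i
  · simp only [Option.isSome_map, Option.isSome_iff_exists] at hf
    choose t ht using hf
    refine (progresses_iff (r := fun n => G.rule (t n)) fun n => by simp [ht]).mp
      (G.progresses t f fun n => ?_)
    have hstep : G.walk s (branchNode f (n + 1)) = _ := G.walk_append_singleton ..
    rw [ht, ht] at hstep
    exact hstep.symm

/-- The disjoint union of a family of proof graphs. -/
def sigma {ι : Type*} {σ : ι → Type*} (G : ∀ i, ProofGraph (σ i)) : ProofGraph (Σ i, σ i) where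
  rule s := (G s.1).rule s.2
  next s k := ((G s.1).next s.2 k).map (Sigma.mk s.1)
  map_concl_next s k := by simpa [Function.comp_def] using (G s.1).map_concl_next s.2 k
  isSlimCutFree s := (G s.1).isSlimCutFree s.2
  progresses s f hs := by
    obtain ⟨i, hi⟩ : ∃ i, ∀ n, ∃ t, s n = ⟨i, t⟩ := by
      refine ⟨(s 0).1, fun n => ?_⟩
      induction n with
      | zero => exact ⟨(s 0).2, rfl⟩
      | succ n ih =>
        obtain ⟨t, ht⟩ := ih
        have hnext := hs n
        rw [ht] at hnext
        obtain ⟨t', -, ht'⟩ := Option.map_eq_some_iff.mp hnext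
        exact ⟨t', ht'.symm⟩
    choose t ht using hi
    obtain rfl : s = fun n => ⟨i, t n⟩ := funext ht
    refine (G i).progresses t f fun n => ?_
    simpa using hs n

/-- The proof graph obtained from `G` by adding the states `τ`, from which a branch may pass to
`G`. -/
def extend {σ τ : Type*} (G : ProofGraph σ) (rule : τ → Inference) (next : τ → ℕ → Option (σ ⊕ τ))
    (map_concl_next : ∀ t i, (next t i).map (Sum.elim (fun s => (G.rule s).concl)
      fun t => (rule t).concl) = (rule t).premises[i]?)
    (isSlimCutFree : ∀ t, (rule t).IsSlimCutFree)
    (progresses : ∀ (t : ℕ → τ) (f : ℕ → ℕ), (∀ n, next (t n) (f n) = some (.inr (t (n + 1)))) →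
      Progresses (fun n => rule (t n)) f) :
    ProofGraph (σ ⊕ τ) where
  rule := Sum.elim G.rule rule
  next := Sum.elim (fun s i => (G.next s i).map .inl) next
  map_concl_next
    | .inl s, i => by simpa [Function.comp_def] using G.map_concl_next s i
    | .inr t, i => by
      rw [Sum.elim_inr, Sum.elim_inr, ← map_concl_next]
      congr 1
      funext x
      cases x <;> rfl
  isSlimCutFree
    | .inl s => G.isSlimCutFree s
    | .inr t => isSlimCutFree t
  progresses x f hx := by
    by_cases hτ : ∀ n, ∃ t, x n = .inr t
    · choose t ht using hτ
      simp only [ht, Sum.elim_inr] at hx ⊢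
      exact progresses t f hx
    · push Not at hτ
      obtain ⟨k, hk⟩ := hτ
      have hσ (n : ℕ) : ∃ s, x (n + k) = .inl s := by
        induction n with
        | zero =>
          rw [Nat.zero_add]
          rcases hxk : x k with s | t
          · exact ⟨s, rfl⟩
          · exact (hk t hxk).elim
        | succ n ih =>
          obtain ⟨s, hs⟩ := ih
          have hnext := hx (n + k)
          rw [hs] at hnext
          obtain ⟨s', -, hs'⟩ := Option.map_eq_some_iff.mp hnext
          exact ⟨s', by rw [hs', Nat.add_right_comm]⟩
      choose s hs using hσ
      refine .of_add k ?_
      simp only [hs, Sum.elim_inl]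
      refine G.progresses s _ fun n => ?_
      have hnext := hx (n + k)
      rw [hs, Nat.add_right_comm, hs] at hnext
      simpa using hnext

end ProofGraph

/-- Slim cut-free provability, in terms of proof graphs. -/
def Derivable (S : Sequent) : Prop :=
  ∃ (σ : Type) (G : ProofGraph σ) (s : σ), (G.rule s).concl = S

theorem Derivable.exists_infProof {S : Sequent} (h : Derivable S) :
    ∃ π : InfProof, π.root = S ∧ π.Slim ∧ π.CutFree := by
  obtain ⟨σ, G, s, rfl⟩ := h
  exact G.exists_unfolding s

theorem exists_proofGraph_of_derivable :
    ∃ (σ : Type) (G : ProofGraph σ), ∀ S, Derivable S → ∃ s, (G.rule s).concl = S := by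
  choose σ G s hs using fun S : {S // Derivable S} => S.2
  exact ⟨_, .sigma G, fun S hS => ⟨⟨⟨S, hS⟩, s ⟨S, hS⟩⟩, hs ⟨S, hS⟩⟩⟩

/-- A branch that stays in `Z` forever decreases the
rank between any two of its passages through the right premise of `(□⁺)`, so there are infinitely
many of these. -/
theorem Derivable.coinduction {α : Type*} [LT α] [WellFoundedLT α] (rank : Sequent → α) (C : Fm)
    {Z : Set Sequent}
    (hZ : ∀ S ∈ Z, ¬ Derivable S → ∃ r : Inference, r.concl = S ∧ r.IsSlimCutFree ∧
      ∀ i S', r.premises[i]? = some S' → Derivable S' ∨ S' ∈ Z ∧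
        (¬ r.IsModal ∧ rank S' < rank S ∨ r.IsBoxPlus C ∧ i = 1))
    {S : Sequent} (hS : S ∈ Z) : Derivable S := by
  by_contra hd
  obtain ⟨σ, G, hG⟩ := exists_proofGraph_of_derivable
  let τ := {S // S ∈ Z ∧ ¬ Derivable S}
  choose rule hconcl hslim hprem using fun T : τ => hZ T.1 T.2.1 T.2.2
  have hnext (T : τ) (i : ℕ) : ∃ o : Option (σ ⊕ τ),
      o.map (Sum.elim (fun s => (G.rule s).concl) Subtype.val) = (rule T).premises[i]? ∧
      ∀ T', o = some (.inr T') → ¬ (rule T).IsModal ∧ rank T'.1 < rank T.1 ∨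
        (rule T).IsBoxPlus C ∧ i = 1 := by
    rcases hp : (rule T).premises[i]? with _ | S'
    · exact ⟨none, rfl, by simp⟩
    · by_cases hS' : Derivable S'
      · obtain ⟨s, hs⟩ := hG S' hS'
        exact ⟨some (.inl s), by simp [hs], by simp⟩
      · obtain ⟨hmem, hstep⟩ := (hprem T i S' hp).resolve_left hS'
        refine ⟨some (.inr ⟨S', hmem, hS'⟩), rfl, ?_⟩
        rintro _ ⟨⟩
        exact hstep
  choose next hmap hstep using hnext
  refine hd ⟨_, G.extend rule next (fun T i => ?_) hslim fun T f hT =>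
    progresses_of_rank (C := C) (fun n => rank (T n).1) fun n => hstep _ _ _ (hT n),
    .inr ⟨S, hS, hd⟩, hconcl _⟩
  simpa only [hconcl] using hmap T i

theorem derivable_concl {r : Inference} (hr : r.IsSlimCutFree)
    (h : ∀ S ∈ r.premises, Derivable S) : Derivable r.concl := by
  refine .coinduction (fun _ => 0) .bot (Z := {r.concl}) ?_ rfl
  rintro _ rfl -
  exact ⟨r, rfl, hr, fun i S hi => .inl (h S (List.mem_of_getElem? hi))⟩

/-! ### Neighbourhood models and soundness -/

theorem not_frequently_succ_lt {α : Type*} [PartialOrder α] [WellFoundedLT α] {g : ℕ → α}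
    (h : ∀ᶠ n in atTop, g (n + 1) ≤ g n) : ¬ ∃ᶠ n in atTop, g (n + 1) < g n := by
  obtain ⟨N, hN⟩ := eventually_atTop.mp h
  have hanti : Antitone fun n => g (N + n) :=
    antitone_nat_of_succ_le fun n => hN (N + n) (Nat.le_add_right N n)
  obtain ⟨n, hn⟩ := WellFoundedLT.antitone_chain_condition hanti
  refine not_frequently.mpr (eventually_atTop.mpr ⟨N + n, fun m hm => ?_⟩)
  obtain ⟨k, rfl⟩ := Nat.exists_eq_add_of_le hm
  have hconst : g (N + n + k) = g (N + n + k + 1) := by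
    simpa only [Nat.add_assoc] using
      (hn (n + k) (by omega)).symm.trans (hn (n + k + 1) (by omega))
  exact hconst.not_gt

/-- The first stage of the descending approximation of the greatest fixed point of `f` that does
not contain `a`. It is only meaningful for `a ∉ f.gfp`. -/
noncomputable def gfpRank {α : Type*} (f : Set α →o Set α) (a : α) : Ordinal :=
  sInf {o | a ∉ gfpApprox f ⊤ o}

theorem notMem_apply_of_notMem_gfp {α : Type*} {f : Set α →o Set α} {a : α} (ha : a ∉ f.gfp) :
    a ∉ f {b | b ∉ f.gfp → gfpRank f a ≤ gfpRank f b} := by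
  have hrank : a ∉ gfpApprox f ⊤ (gfpRank f a) := by
    obtain ⟨o, ho⟩ := gfp_mem_range_gfpApprox f
    exact csInf_mem (s := {o | a ∉ gfpApprox f ⊤ o}) ⟨o, by rwa [Set.mem_ofPred_eq, ho]⟩
  intro hf
  rw [gfpApprox] at hrank
  refine hrank ⟨trivial, Set.mem_iInter₂.mpr fun o ho => f.monotone (fun b hb => ?_) hf⟩
  by_contra hbo
  have hgfp : f.gfp ≤ gfpApprox f ⊤ o :=
    le_gfpApprox_of_mem_fixedPoints f f.isFixedPt_gfp le_top o
  exact ((hb fun h => hbo (hgfp h)).trans (csInf_le' hbo)).not_gt ho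

/-- A model on the set `W` of worlds: a neighbourhood filter at every world, and the set of worlds
at which a given propositional variable is true. -/
structure Model (W : Type*) where
  nbhd : W → Filter W
  val : ℕ → Set W

namespace Model

variable {W : Type*} (M : Model W)

/-- The operation on sets of worlds that interprets `□`. -/
def box (X : Set W) : Set W := {w | ∀ᶠ v in M.nbhd w, v ∈ X}

theorem notMem_box {X : Set W} {w : W} : w ∉ M.box X ↔ ∃ᶠ v in M.nbhd w, v ∉ X :=
  not_eventually

theorem box_mono : Monotone M.box := fun _ _ h _ hw => hw.mono h

/-- The operator whose greatest fixed point interprets `□⁺`. -/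
def boxPlusOp (X : Set W) : Set W →o Set W where
  toFun Y := M.box (X ∩ Y)
  monotone' _ _ h := M.box_mono (Set.inter_subset_inter_right X h)

/-- The operation on sets of worlds that interprets `□⁺`. -/
def boxPlus (X : Set W) : Set W := (M.boxPlusOp X).gfp

theorem box_inter_boxPlus (X : Set W) : M.box (X ∩ M.boxPlus X) = M.boxPlus X :=
  (M.boxPlusOp X).map_gfp

theorem subset_boxPlus {X Y : Set W} (h : Y ⊆ M.box (X ∩ Y)) : Y ⊆ M.boxPlus X :=
  (M.boxPlusOp X).le_gfp h

/-- The set of worlds at which a formula is true. -/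
def truth : Fm → Set W
  | .var p => M.val p
  | .bot => ∅
  | .imp A B => {w | w ∈ truth A → w ∈ truth B}
  | .box A => M.box (truth A)
  | .boxPlus A => M.boxPlus (truth A)

/-- For a world at which `□⁺A` is false, the stage at which this is detected; `0` for formulas of
any other form. -/
noncomputable def rank : Fm → W → Ordinal
  | .boxPlus A, w => gfpRank (M.boxPlusOp (M.truth A)) w
  | _, _ => 0

/-- The world `w` is a counterexample to the sequent. The formulas to the left of the semicolon
are assumed to be necessary at all worlds, not just at `w`. -/
structure Refutes (w : W) (S : Sequent) : Prop where
  sig : ∀ A ∈ S.Sig, ∀ v, v ∈ M.box (M.truth A)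
  ant : ∀ A ∈ S.ant, w ∈ M.truth A
  suc : ∀ A ∈ S.suc, w ∉ M.truth A

variable {M} {w : W} {Sig : Set Fm} {Sig₀ : Finset Fm} {Λ P Φ Ψ : Multiset Fm} {A : Fm}

theorem Refutes.eventually {Δ : Multiset Fm}
    (h : M.Refutes w ⟨Sig, Φ + Λ.map Fm.box + P.map Fm.boxPlus, Δ⟩)
    (hSig : (Sig₀ : Set Fm) ⊆ Sig) :
    ∀ᶠ v in M.nbhd w, ∀ A ∈ Sig₀.val + Λ + P + P.map Fm.boxPlus, v ∈ M.truth A := by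
  have hP (B : Fm) (hB : B ∈ P) : w ∈ M.box (M.truth B ∩ M.boxPlus (M.truth B)) := by
    rw [box_inter_boxPlus]
    exact h.ant (.boxPlus B) (by simp [hB])
  refine (eventually_all_finite (Multiset.finite_toSet _)).mpr fun A hA => ?_
  simp only [Set.mem_ofPred_eq, Multiset.mem_add, Multiset.mem_map, Finset.mem_val] at hA
  rcases hA with ((hA | hA) | hA) | ⟨B, hB, rfl⟩
  · exact h.sig A (hSig hA) w
  · exact h.ant (.box A) (by simp [hA])
  · exact (hP A hA).mono fun v hv => hv.1
  · exact (hP B hB).mono fun v hv => hv.2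

theorem Refutes.exists_box_premise
    (h : M.Refutes w (Inference.box Sig Sig₀ hSig Λ P Φ Ψ A).concl) :
    ∃ v, M.Refutes v ⟨Sig, Sig₀.val + Λ + P + P.map Fm.boxPlus, {A}⟩ := by
  have hA : ∃ᶠ v in M.nbhd w, v ∉ M.truth A :=
    M.notMem_box.mp (h.suc (.box A) (by simp [Inference.concl]))
  obtain ⟨v, hvA, hv⟩ := (hA.and_eventually (h.eventually hSig)).exists
  exact ⟨v, h.sig, hv, by simpa using hvA⟩

theorem Refutes.exists_boxPlus_premise
    (h : M.Refutes w (Inference.boxPlus Sig Sig₀ hSig Λ P Φ Ψ A).concl) :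
    ∃ v, M.Refutes v ⟨Sig, Sig₀.val + Λ + P + P.map Fm.boxPlus, {A}⟩ ∨
      M.Refutes v ⟨Sig, Sig₀.val + Λ + P + P.map Fm.boxPlus, {.boxPlus A}⟩ ∧
        M.rank (.boxPlus A) v < M.rank (.boxPlus A) w := by
  have hA : ∃ᶠ v in M.nbhd w, v ∉ M.truth A ∩ {v | v ∉ M.truth (.boxPlus A) →
      M.rank (.boxPlus A) w ≤ M.rank (.boxPlus A) v} :=
    M.notMem_box.mp
      (notMem_apply_of_notMem_gfp (h.suc (.boxPlus A) (by simp [Inference.concl])))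
  obtain ⟨v, hvA, hv⟩ := (hA.and_eventually (h.eventually hSig)).exists
  refine ⟨v, ?_⟩
  by_cases hvA' : v ∈ M.truth A
  · obtain ⟨hvC, hlt⟩ := Classical.not_imp.mp fun hle => hvA ⟨hvA', hle⟩
    exact .inr ⟨⟨h.sig, hv, by simpa using hvC⟩, not_le.mp hlt⟩
  · exact .inl ⟨h.sig, hv, by simpa using hvA'⟩

theorem Refutes.exists_premise_of_not_isModal {r : Inference} (hr : ¬ r.IsModal)
    (h : M.Refutes w r.concl) :
    ∃ (i : ℕ) (S : Sequent), r.premises[i]? = some S ∧ M.Refutes w S := by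
  obtain ⟨hsig, hant, hsuc⟩ := h
  cases r with simp only [Inference.concl, Multiset.forall_mem_cons] at hsig hant hsuc
  | ax => exact absurd hant.1 hsuc.1
  | botL => exact hant.1.elim
  | impL Sig Γ Δ A B =>
    by_cases hA : w ∈ M.truth A
    · exact ⟨0, _, rfl, hsig, by simpa using ⟨hant.1 hA, hant.2⟩, hsuc⟩
    · exact ⟨1, _, rfl, hsig, hant.2, by simpa using ⟨hA, hsuc⟩⟩
  | impR Sig Γ Δ A B =>
    obtain ⟨hA, hB⟩ := Classical.not_imp.mp hsuc.1
    exact ⟨0, _, rfl, hsig, by simpa using ⟨hA, hant⟩, by simpa using ⟨hB, hsuc.2⟩⟩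
  | cut Sig Γ Δ A =>
    by_cases hA : w ∈ M.truth A
    · exact ⟨1, _, rfl, hsig, by simpa using ⟨hA, hant⟩, hsuc⟩
    · exact ⟨0, _, rfl, hsig, hant, by simpa using ⟨hA, hsuc⟩⟩
  | box => exact (hr (.inl trivial)).elim
  | boxPlus => exact (hr (.inr ⟨_, rfl⟩)).elim

theorem Refutes.exists_premise {r : Inference} (h : M.Refutes w r.concl) :
    ∃ (i : ℕ) (v : W) (S : Sequent), r.premises[i]? = some S ∧ M.Refutes v S ∧
      ∀ C, r.IsTailStep C i →
        M.rank C v ≤ M.rank C w ∧ (r.IsBoxPlus C → M.rank C v < M.rank C w) := by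
  by_cases hr : r.IsModal
  · cases r with
    | box =>
      obtain ⟨v, hv⟩ := h.exists_box_premise
      exact ⟨0, v, _, rfl, hv, fun C hC => (hC.2 trivial).elim⟩
    | boxPlus =>
      obtain ⟨v, hv | ⟨hv, hlt⟩⟩ := h.exists_boxPlus_premise
      · exact ⟨0, v, _, rfl, hv, fun C hC => ((hC.1 _ rfl).2 rfl).elim⟩
      · refine ⟨1, v, _, rfl, hv, fun C hC => ?_⟩
        obtain ⟨rfl, -⟩ := hC.1 _ rfl
        exact ⟨hlt.le, fun _ => hlt⟩
    | _ => exact (hr.elim id fun ⟨_, h⟩ => h).elim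
  · obtain ⟨i, S, hS, hv⟩ := h.exists_premise_of_not_isModal hr
    exact ⟨i, w, S, hS, hv, fun C _ => ⟨le_rfl, fun hC => (hr (.inr ⟨C, hC⟩)).elim⟩⟩

end Model

/-- A refuted root would give a branch of refuted sequents. In its tail the rank of the common
principal formula would never increase, and decrease infinitely often. -/
theorem InfProof.not_refutes_root (π : InfProof) {W : Type*} (M : Model W) (w : W) :
    ¬ M.Refutes w π.root := by
  intro hw
  obtain ⟨f, r, s, hlabel, hstep⟩ := π.exists_branch (fun _ _ => Model.Refutes.exists_premise) hw
  obtain ⟨C, htail, hright⟩ := π.progresses hlabel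
  exact not_frequently_succ_lt (g := fun n => M.rank C (s n))
    (htail.mono fun n hn => (hstep n C hn).1)
    ((hright.and_eventually htail).mono fun n hn => (hstep n C hn.2).2 hn.1.1)

/-! ### The canonical model -/

/-- The number of implications that are not in the scope of a modality. It measures how far a
formula is from being decomposed by the rules for `→`. -/
def Fm.size : Fm → ℕ
  | .imp A B => A.size + B.size + 1
  | _ => 0

/-- The total size of the formulas to the right of the semicolon. -/
def Sequent.size (S : Sequent) : ℕ := (S.ant.map Fm.size).sum + (S.suc.map Fm.size).sum

/-- A sequent to which no rule for `→` applies. -/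
def Sequent.IsSaturated (S : Sequent) : Prop :=
  ∀ A B, Fm.imp A B ∉ S.ant ∧ Fm.imp A B ∉ S.suc

/-- The formulas `A` with `□A` in `Γ`. -/
noncomputable def boxArgs (Γ : Multiset Fm) : Finset Fm :=
  (Γ.finite_toSet.preimage (f := Fm.box) fun _ _ _ _ => Fm.box.inj).toFinset

/-- The formulas `A` with `□⁺A` in `Γ`. -/
noncomputable def boxPlusArgs (Γ : Multiset Fm) : Finset Fm :=
  (Γ.finite_toSet.preimage (f := Fm.boxPlus) fun _ _ _ _ => Fm.boxPlus.inj).toFinset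

/-- The antecedent `Σ₀, Λ, Π, □⁺Π` of the premises when a modal rule is applied slimly to a sequent
with antecedent `Γ` and as few formulas as possible are discarded. -/
noncomputable def modalAnt (Sig₀ : Finset Fm) (Γ : Multiset Fm) : Multiset Fm :=
  Sig₀.val + (boxArgs Γ).val + (boxPlusArgs Γ).val + (boxPlusArgs Γ).val.map Fm.boxPlus

section ModalRules

variable {Sig : Set Fm} {Sig₀ : Finset Fm} {Γ Δ : Multiset Fm} {A : Fm}

theorem mem_boxArgs : A ∈ boxArgs Γ ↔ Fm.box A ∈ Γ := by
  simp [boxArgs]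

theorem mem_boxPlusArgs : A ∈ boxPlusArgs Γ ↔ Fm.boxPlus A ∈ Γ := by
  simp [boxPlusArgs]

theorem mem_modalAnt : A ∈ modalAnt Sig₀ Γ ↔
    A ∈ Sig₀ ∨ .box A ∈ Γ ∨ .boxPlus A ∈ Γ ∨ ∃ B, .boxPlus B ∈ Γ ∧ .boxPlus B = A := by
  simp only [modalAnt, Multiset.mem_add, Multiset.mem_map, Finset.mem_val, mem_boxArgs,
    mem_boxPlusArgs, or_assoc]

theorem exists_eq_add_map_args (Γ : Multiset Fm) :
    ∃ Φ, Γ = Φ + (boxArgs Γ).val.map Fm.box + (boxPlusArgs Γ).val.map Fm.boxPlus := by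
  have hle : (boxArgs Γ).val.map Fm.box + (boxPlusArgs Γ).val.map Fm.boxPlus ≤ Γ := by
    refine Multiset.le_iff_subset (Multiset.nodup_add.mpr
      ⟨(boxArgs Γ).nodup.map fun _ _ => Fm.box.inj,
        (boxPlusArgs Γ).nodup.map fun _ _ => Fm.boxPlus.inj, ?_⟩) |>.mpr fun A hA => ?_
    · simp [Multiset.disjoint_left]
    · simp only [Multiset.mem_add, Multiset.mem_map, Finset.mem_val, mem_boxArgs,
        mem_boxPlusArgs] at hA
      rcases hA with ⟨B, hB, rfl⟩ | ⟨B, hB, rfl⟩ <;> exact hB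
  obtain ⟨Φ, hΦ⟩ := Multiset.le_iff_exists_add.mp hle
  exact ⟨Φ, hΦ.trans (by rw [add_comm, add_assoc])⟩

theorem Derivable.of_modalAnt_box (hSig : (Sig₀ : Set Fm) ⊆ Sig) (hA : .box A ∈ Δ)
    (h : Derivable ⟨Sig, modalAnt Sig₀ Γ, {A}⟩) : Derivable ⟨Sig, Γ, Δ⟩ := by
  obtain ⟨Φ, hΦ⟩ := exists_eq_add_map_args Γ
  obtain ⟨Ψ, rfl⟩ := Multiset.exists_cons_of_mem hA
  have hconcl := derivable_concl
    (r := .box Sig Sig₀ hSig (boxArgs Γ).val (boxPlusArgs Γ).val Φ Ψ A)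
    ⟨⟨(boxArgs Γ).nodup, (boxPlusArgs Γ).nodup⟩, id⟩ (List.forall_mem_singleton.mpr h)
  rwa [Inference.concl, ← hΦ] at hconcl

theorem exists_boxPlus_inference (hSig : (Sig₀ : Set Fm) ⊆ Sig) (hA : .boxPlus A ∈ Δ) :
    ∃ r : Inference, r.concl = ⟨Sig, Γ, Δ⟩ ∧ r.IsSlimCutFree ∧ r.IsBoxPlus (.boxPlus A) ∧
      r.premises = [⟨Sig, modalAnt Sig₀ Γ, {A}⟩, ⟨Sig, modalAnt Sig₀ Γ, {.boxPlus A}⟩] := by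
  obtain ⟨Φ, hΦ⟩ := exists_eq_add_map_args Γ
  obtain ⟨Ψ, rfl⟩ := Multiset.exists_cons_of_mem hA
  refine ⟨.boxPlus Sig Sig₀ hSig (boxArgs Γ).val (boxPlusArgs Γ).val Φ Ψ A, ?_,
    ⟨⟨(boxArgs Γ).nodup, (boxPlusArgs Γ).nodup⟩, id⟩, rfl, rfl⟩
  rw [Inference.concl, ← hΦ]

end ModalRules

/-- A point of the canonical model: a sequent `Sig; ant ⇒ suc` without a slim cut-free proof. -/
structure Point (Sig : Set Fm) where
  ant : Multiset Fm
  suc : Multiset Fm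
  not_derivable : ¬ Derivable ⟨Sig, ant, suc⟩

namespace Point

variable {Sig : Set Fm}

mutual

/-- The formula can be read off the point as a true one. Implications are reduced to their parts,
so a point need not be saturated. -/
def Asserts (u : Point Sig) : Fm → Prop
  | .bot => False
  | .imp A B => u.Denies A ∨ u.Asserts B
  | A => A ∈ u.ant

/-- The formula can be read off the point as a false one. -/
def Denies (u : Point Sig) : Fm → Prop
  | .bot => True
  | .imp A B => u.Asserts A ∧ u.Denies B
  | A => A ∈ u.suc

end

/-- By what it asserts and denies, the point is a counterexample to the sequent. Formulas to the
left of the semicolon are disregarded; those in `Sig` are valid in the canonical model. -/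
structure Realizes (u : Point Sig) (S : Sequent) : Prop where
  asserts : ∀ A ∈ S.ant, u.Asserts A
  denies : ∀ A ∈ S.suc, u.Denies A

theorem realizes_of_isSaturated (u : Point Sig)
    (h : (⟨Sig, u.ant, u.suc⟩ : Sequent).IsSaturated) : u.Realizes ⟨Sig, u.ant, u.suc⟩ := by
  have hbot : .bot ∉ u.ant := fun hbot => u.not_derivable <| by
    obtain ⟨Γ, hΓ⟩ := Multiset.exists_cons_of_mem hbot
    rw [hΓ]
    exact derivable_concl (r := .botL Sig Γ u.suc) ⟨trivial, id⟩ (by simp [Inference.premises])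
  refine ⟨fun A hA => ?_, fun A hA => ?_⟩ <;> cases A
  case refine_1.bot => exact (hbot hA).elim
  case refine_1.imp A B => exact ((h A B).1 hA).elim
  case refine_2.bot => trivial
  case refine_2.imp A B => exact ((h A B).2 hA).elim
  all_goals exact hA

theorem exists_reduction {S : Sequent} (h : ¬ S.IsSaturated) :
    ∃ r : Inference, r.concl = S ∧ r.IsSlimCutFree ∧ ¬ r.IsModal ∧
      ∀ S' ∈ r.premises, S'.size < S.size ∧ ∀ u : Point Sig, u.Realizes S' → u.Realizes S := by
  obtain ⟨Sig', Γ, Δ⟩ := S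
  simp only [Sequent.IsSaturated, not_forall, not_and_or, not_not] at h
  obtain ⟨A, B, hAB | hAB⟩ := h
  · obtain ⟨Γ, rfl⟩ := Multiset.exists_cons_of_mem hAB
    refine ⟨.impL Sig' Γ Δ A B, rfl, ⟨trivial, id⟩, (·.elim id fun ⟨_, h⟩ => h), ?_⟩
    refine List.forall_mem_cons.mpr ⟨⟨?_, fun u ⟨hant, hsuc⟩ => ?_⟩,
      List.forall_mem_singleton.mpr ⟨?_, fun u ⟨hant, hsuc⟩ => ?_⟩⟩
    · simp only [Sequent.size, Fm.size, Multiset.map_cons, Multiset.sum_cons]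
      omega
    · obtain ⟨hB, hΓ⟩ := Multiset.forall_mem_cons.mp hant
      exact ⟨Multiset.forall_mem_cons.mpr ⟨.inr hB, hΓ⟩, hsuc⟩
    · simp only [Sequent.size, Fm.size, Multiset.map_cons, Multiset.sum_cons]
      omega
    · obtain ⟨hA, hΔ⟩ := Multiset.forall_mem_cons.mp hsuc
      exact ⟨Multiset.forall_mem_cons.mpr ⟨.inl hA, hant⟩, hΔ⟩
  · obtain ⟨Δ, rfl⟩ := Multiset.exists_cons_of_mem hAB
    refine ⟨.impR Sig' Γ Δ A B, rfl, ⟨trivial, id⟩, (·.elim id fun ⟨_, h⟩ => h), ?_⟩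
    refine List.forall_mem_singleton.mpr ⟨?_, fun u ⟨hant, hsuc⟩ => ?_⟩
    · simp only [Sequent.size, Fm.size, Multiset.map_cons, Multiset.sum_cons]
      omega
    · obtain ⟨hA, hΓ⟩ := Multiset.forall_mem_cons.mp hant
      obtain ⟨hB, hΔ⟩ := Multiset.forall_mem_cons.mp hsuc
      exact ⟨hΓ, Multiset.forall_mem_cons.mpr ⟨⟨hA, hB⟩, hΔ⟩⟩

theorem exists_realizes {S : Sequent} (hSig : S.Sig = Sig) (h : ¬ Derivable S) :
    ∃ u : Point Sig, u.Realizes S := by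
  induction hn : S.size using Nat.strong_induction_on generalizing S with
  | _ n ih =>
    subst hn
    by_cases hsat : S.IsSaturated
    · subst hSig
      exact ⟨⟨S.ant, S.suc, h⟩, realizes_of_isSaturated _ hsat⟩
    · obtain ⟨r, rfl, hslim, -, hprem⟩ := exists_reduction (Sig := Sig) hsat
      obtain ⟨S', hS', hd⟩ : ∃ S' ∈ r.premises, ¬ Derivable S' := by
        by_contra! hd
        exact h (derivable_concl hslim hd)
      obtain ⟨hlt, hreal⟩ := hprem S' hS'
      obtain ⟨u, hu⟩ :=
        ih _ hlt ((Inference.Sig_of_mem_premises hS').trans hSig) hd rfl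
      exact ⟨u, hreal u hu⟩

/-- The filter of neighbourhoods of a point in the canonical model. It is generated by the sets of
all points at which the antecedent of a premise of a modal rule holds, for rules applied to `u`. -/
def nbhd (u : Point Sig) : Filter (Point Sig) where
  sets := {X | ∃ Sig₀ : Finset Fm, (Sig₀ : Set Fm) ⊆ Sig ∧
    ∀ v : Point Sig, (∀ A ∈ modalAnt Sig₀ u.ant, v.Asserts A) → v ∈ X}
  univ_sets := ⟨∅, by simp, fun _ _ => trivial⟩
  sets_of_superset := fun ⟨Sig₀, hSig, hX⟩ hXY => ⟨Sig₀, hSig, fun v hv => hXY (hX v hv)⟩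
  inter_sets := fun ⟨Sig₀, hSig₀, hX⟩ ⟨Sig₁, hSig₁, hY⟩ => by
    classical
    refine ⟨Sig₀ ∪ Sig₁, by simpa using ⟨hSig₀, hSig₁⟩, fun v hv => ?_⟩
    simp only [mem_modalAnt, Finset.mem_union] at hX hY hv
    exact ⟨hX v fun A hA => hv A (by tauto), hY v fun A hA => hv A (by tauto)⟩

/-- The canonical model. A point refutes the sequents that it realizes, see `Realizes.refutes`. -/
def canonicalModel (Sig : Set Fm) : Model (Point Sig) where
  nbhd := nbhd
  val p := {u | .var p ∈ u.ant}

theorem derivable_modalAnt {Sig₀ : Finset Fm} {Γ : Multiset Fm} {A : Fm} {X : Set (Point Sig)}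
    (hX : ∀ v ∈ X, ¬ v.Denies A)
    (h : ∀ v : Point Sig, (∀ B ∈ modalAnt Sig₀ Γ, v.Asserts B) → v ∈ X) :
    Derivable ⟨Sig, modalAnt Sig₀ Γ, {A}⟩ := by
  by_contra hd
  obtain ⟨v, hv⟩ := exists_realizes (Sig := Sig) rfl hd
  exact hX v (h v hv.asserts) (hv.denies A (by simp))

theorem notMem_box_of_denies {u : Point Sig} {A : Fm} {X : Set (Point Sig)}
    (hX : ∀ v ∈ X, ¬ v.Denies A) (hA : u.Denies (.box A)) : u ∉ (canonicalModel Sig).box X := by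
  rintro ⟨Sig₀, hSig, h⟩
  exact u.not_derivable (.of_modalAnt_box hSig hA (derivable_modalAnt hX h))

/-- The invariant of the right premises of `(□⁺)` in the construction of a cut-free proof: all
counterexamples to the sequent lie in `□⁺X` and have `□⁺A` in their succedents. -/
def boxPlusInvariant (X : Set (Point Sig)) (A : Fm) : Set Sequent :=
  {S | S.Sig = Sig ∧ ∀ v : Point Sig, v.Realizes S →
    v ∈ (canonicalModel Sig).boxPlus X ∧ v.Denies (.boxPlus A)}

section BoxPlus

variable {u : Point Sig} {A : Fm} {X : Set (Point Sig)}

theorem exists_boxPlus_inference_of_mem_boxPlus (hX : ∀ v ∈ X, ¬ v.Denies A)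
    (hu : u ∈ (canonicalModel Sig).boxPlus X) (hA : u.Denies (.boxPlus A)) :
    ∃ (r : Inference) (S₀ S₁ : Sequent), r.concl = ⟨Sig, u.ant, u.suc⟩ ∧ r.IsSlimCutFree ∧
      r.IsBoxPlus (.boxPlus A) ∧ r.premises = [S₀, S₁] ∧ Derivable S₀ ∧
      S₁ ∈ boxPlusInvariant X A := by
  rw [← Model.box_inter_boxPlus] at hu
  obtain ⟨Sig₀, hSig, hu⟩ := hu
  obtain ⟨r, hr, hslim, hC, hprem⟩ := exists_boxPlus_inference hSig hA
  exact ⟨r, _, _, hr, hslim, hC, hprem, derivable_modalAnt hX fun v hv => (hu v hv).1,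
    rfl, fun v hv => ⟨(hu v hv.asserts).2, hv.denies _ (Multiset.mem_singleton_self _)⟩⟩

theorem derivable_of_mem_boxPlusInvariant (hX : ∀ v ∈ X, ¬ v.Denies A) {S : Sequent}
    (hS : S ∈ boxPlusInvariant X A) : Derivable S := by
  refine .coinduction Sequent.size (.boxPlus A) ?_ hS
  rintro S ⟨rfl, hS⟩ hd
  by_cases hsat : S.IsSaturated
  · obtain ⟨hu, hA⟩ := hS ⟨S.ant, S.suc, hd⟩ (realizes_of_isSaturated _ hsat)
    obtain ⟨r, S₀, S₁, hr, hslim, hC, hprem, hS₀, hS₁⟩ :=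
      exists_boxPlus_inference_of_mem_boxPlus hX hu hA
    refine ⟨r, hr, hslim, fun i S' hi => ?_⟩
    rw [hprem] at hi
    match i with
    | 0 => exact .inl (Option.some.inj hi ▸ hS₀)
    | 1 => exact .inr ⟨Option.some.inj hi ▸ hS₁, .inr ⟨hC, rfl⟩⟩
  · obtain ⟨r, rfl, hslim, hmodal, hprem⟩ :=
      exists_reduction (Sig := S.Sig) hsat
    refine ⟨r, rfl, hslim, fun i S' hi => .inr ?_⟩
    have hS' := List.mem_of_getElem? hi
    obtain ⟨hlt, hreal⟩ := hprem S' hS'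
    exact ⟨⟨Inference.Sig_of_mem_premises hS', fun v hv => hS v (hreal v hv)⟩,
      .inl ⟨hmodal, hlt⟩⟩

theorem notMem_boxPlus_of_denies (hX : ∀ v ∈ X, ¬ v.Denies A) (hA : u.Denies (.boxPlus A)) :
    u ∉ (canonicalModel Sig).boxPlus X := by
  intro hu
  obtain ⟨r, S₀, S₁, hr, hslim, -, hprem, hS₀, hS₁⟩ :=
    exists_boxPlus_inference_of_mem_boxPlus hX hu hA
  refine u.not_derivable (hr ▸ derivable_concl hslim ?_)
  rw [hprem]
  exact List.forall_mem_cons.mpr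
    ⟨hS₀, List.forall_mem_singleton.mpr (derivable_of_mem_boxPlusInvariant hX hS₁)⟩

end BoxPlus

theorem truth_lemma (A : Fm) (u : Point Sig) :
    (u.Asserts A → u ∈ (canonicalModel Sig).truth A) ∧
      (u.Denies A → u ∉ (canonicalModel Sig).truth A) := by
  induction A generalizing u with
  | var p =>
    refine ⟨id, fun hsuc hant => u.not_derivable ?_⟩
    obtain ⟨Γ, hΓ⟩ := Multiset.exists_cons_of_mem hant
    obtain ⟨Δ, hΔ⟩ := Multiset.exists_cons_of_mem hsuc
    rw [hΓ, hΔ]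
    exact derivable_concl (r := .ax Sig Γ Δ p) ⟨trivial, id⟩ (List.forall_mem_nil _)
  | bot => exact ⟨False.elim, fun _ => id⟩
  | imp A B ihA ihB =>
    refine ⟨fun h hA => ?_, fun ⟨hA, hB⟩ h => (ihB u).2 hB (h ((ihA u).1 hA))⟩
    exact h.elim (fun hA' => ((ihA u).2 hA' hA).elim) (ihB u).1
  | box A ih =>
    refine ⟨fun h => ⟨∅, by simp, fun v hv => ?_⟩,
      notMem_box_of_denies fun v hv hA => (ih v).2 hA hv⟩
    exact (ih v).1 (hv A (mem_modalAnt.mpr (.inr (.inl h))))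
  | boxPlus A ih =>
    refine ⟨fun h => ?_, notMem_boxPlus_of_denies fun v hv hA => (ih v).2 hA hv⟩
    suffices {v : Point Sig | v.Asserts (.boxPlus A)} ⊆ (canonicalModel Sig).truth (.boxPlus A) from
      this h
    refine Model.subset_boxPlus _ fun v hv => ?_
    refine ⟨∅, by simp, fun w hw => ⟨(ih w).1 (hw A ?_), hw (.boxPlus A) ?_⟩⟩
    · exact mem_modalAnt.mpr (.inr (.inr (.inl hv)))
    · exact mem_modalAnt.mpr (.inr (.inr (.inr ⟨A, hv, rfl⟩)))

theorem Realizes.refutes {S : Sequent} {u : Point S.Sig} (hu : u.Realizes S) :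
    (canonicalModel S.Sig).Refutes u S where
  sig A hA _ := by
    refine ⟨{A}, by simpa using hA, fun v hv => (truth_lemma A v).1 (hv A ?_)⟩
    exact mem_modalAnt.mpr (.inl (Finset.mem_singleton_self A))
  ant A hA := (truth_lemma A u).1 (hu.asserts A hA)
  suc A hA := (truth_lemma A u).2 (hu.denies A hA)

end Point

end KPlus

theorem mainTheorem1 (S : KPlus.Sequent) (h : KPlus.ProvableWithCut S) :
    ∃ π : KPlus.InfProof, π.root = S ∧ π.Slim ∧ π.CutFree := by
  obtain ⟨π, rfl⟩ := h
  refine KPlus.Derivable.exists_infProof (of_not_not fun hd => ?_)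
  obtain ⟨u, hu⟩ := KPlus.Point.exists_realizes rfl hd
  exact π.not_refutes_root _ u hu.refutes
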